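/- Let $W=\{W(t):t\ge 0\}$ be a standard Brownian motion with $W(0)=0$. For $b\neq 0$ and $\varepsilon>0$ let $$V_\varepsilon(b)=\frac1\varepsilon\,\mathrm{Leb}\bigl\{t\ge 0:\ bt-\tfrac12\varepsilon\le W(t)\le bt+\tfrac12\varepsilon\bigr\}.$$ Then there is a process $V=\{V(b):b\ne 0\}$ such that, for all finitely many $b_1,\dots,b_n\neq 0$, the vector $(V(b_1),\dots,V(b_n))$ is the limit in distribution of $(V_\varepsilon(b_1),\dots,V_\varepsilon(b_n))$ as $\varepsilon\downarrow 0$. Every such process $V$ has square integrable marginals and the following covariances and correlations. 1. For $0<b<c$, $$\operatorname{cov}\{V(b),V(c)\}=\frac{1}{c(2c-b)}.$$ 2. For $-c<0<d$, $$\operatorname{cov}\{V(-c),V(d)\}=\frac{1}{d(c+2d)}+\frac{1}{c(2c+d)}-\frac{1}{cd}.$$ 3. For $b>0$ and $h>0$, $$\operatorname{corr}\{V(b),V(b+h)\}=\frac{b}{b+2h}.$$ 4. For $c>0$ and $k>0$, $$\operatorname{corr}\{V(-c),V(kc)\}=-\frac{3k}{(k+2)(2k+1)}.$$ -/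

import Mathlib

open MeasureTheory ProbabilityTheory Filter Topology
open scoped NNReal

noncomputable section

/-- The relative time that the path `t ↦ W t ω` spends in the strip of width `ε` around the ray
`x = b t`, namely `ε⁻¹ · Lebesgue measure {t ≥ 0 | b t - ε/2 ≤ W t ω ≤ b t + ε/2}`. -/
def relTime {Ω : Type*} (W : ℝ≥0 → Ω → ℝ) (ε b : ℝ) (ω : Ω) : ℝ :=
  (1 / ε) * volume.real
    {t : ℝ | 0 ≤ t ∧ W t.toNNReal ω ∈ Set.Icc (b * t - ε / 2) (b * t + ε / 2)}

/-- `V = {V(b) : b ≠ 0}` is a total relative time process of `W`: for all finitely many non-zero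
slopes `b₁, …, bₙ`, the vector `(V(b₁), …, V(bₙ))` is the limit in distribution of
`(V_ε(b₁), …, V_ε(bₙ))` as `ε ↓ 0`, where `V_ε(b)` is `relTime W ε b`. The process `V` may live on
another probability space than `W`; the value `V 0` is irrelevant. -/
def IsTotalRelTime {Ω Ω' : Type*} [MeasurableSpace Ω] [MeasurableSpace Ω']
    (W : ℝ≥0 → Ω → ℝ) (P : Measure Ω) [IsProbabilityMeasure P]
    (V : ℝ → Ω' → ℝ) (P' : Measure Ω') [IsProbabilityMeasure P'] : Prop :=
  ∀ (n : ℕ) (b : Fin n → ℝ), (∀ i, b i ≠ 0) →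
    TendstoInDistribution (fun (ε : ℝ) (ω : Ω) (i : Fin n) ↦ relTime W ε (b i) ω) (𝓝[>] 0)
      (fun (ω : Ω') (i : Fin n) ↦ V (b i) ω) (fun _ ↦ P) P'

/-- The correlation coefficient of two real random variables. -/
def correlation {Ω : Type*} [MeasurableSpace Ω] (X Y : Ω → ℝ) (P : Measure Ω) : ℝ :=
  covariance X Y P / (√(variance X P) * √(variance Y P))

end

open scoped ENNReal

/-! Everything reduces to first and second moments. For slopes `b`, `c` and widths `ε`, `δ`, Tonelli
writes `E[V_ε(b) V_δ(c)]` as an integral over pairs of times, split into `s < t` and `t < s`. For `s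
< t`, independence of increments factors the joint density, and integrating out `t - s` leaves the
potential density `|c|⁻¹ exp(-cz - |cz|)` of Brownian motion with drift `-c`
(`lintegral_gaussianPDF_linear`). What remains is `rayKernel b c`, bounded and continuous at the
origin. So as `ε` and `δ` tend to `0` independently, the means tend to `1/|b|` and the mixed moments
to `K(b,c) + K(c,b)`, where `K(b,c) = rayKernel b c 0 0`.

Convergence in two independent widths makes `V_ε(b)` Cauchy in `L²`
(`exists_tendsto_of_tendsto_inner`). The `L²` limits form a total relative time process with these
moments, and uniqueness of limits in distribution passes the moments to any other one.

Finally `K(b,c)` is `1/(|2c - b| |c|)` if `c(c - b) ≥ 0` and `1/(|b| |c|)` if `c(c - b) ≤ 0`; the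
covariance is `K(b,c) + K(c,b) - 1/(|b| |c|)`. -/

/-! ### Potential density of Brownian motion with drift -/

/-- The Gaussian integral `∫₀ˣ exp (-t² / 2) dt`. -/
noncomputable def gaussPrimitive (x : ℝ) : ℝ := ∫ t in (0 : ℝ)..x, Real.exp (-(1 / 2) * t ^ 2)

lemma hasDerivAt_gaussPrimitive (x : ℝ) :
    HasDerivAt gaussPrimitive (Real.exp (-(1 / 2) * x ^ 2)) x :=
  intervalIntegral.integral_hasDerivAt_right
    ((by fun_prop : Continuous fun t : ℝ ↦ Real.exp (-(1 / 2) * t ^ 2)).intervalIntegrable _ _)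
    ((by fun_prop : Continuous fun t : ℝ ↦ Real.exp (-(1 / 2) * t ^ 2)).stronglyMeasurableAtFilter
      _ _) (by fun_prop)

lemma gaussPrimitive_neg (x : ℝ) : gaussPrimitive (-x) = -gaussPrimitive x := by
  have h := intervalIntegral.integral_comp_neg (a := (0 : ℝ)) (b := x)
    (fun t : ℝ ↦ Real.exp (-(1 / 2) * t ^ 2))
  simp only [even_two.neg_pow, neg_zero] at h
  rw [gaussPrimitive, gaussPrimitive, intervalIntegral.integral_symm, h]

lemma tendsto_gaussPrimitive_atTop :
    Tendsto gaussPrimitive atTop (𝓝 (√(2 * Real.pi) / 2)) := by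
  have h := intervalIntegral_tendsto_integral_Ioi (μ := volume) 0
    (integrable_exp_neg_mul_sq (b := 1 / 2) (by norm_num)).integrableOn tendsto_id
  rw [integral_gaussian_Ioi] at h
  rwa [show Real.pi / (1 / 2) = 2 * Real.pi by ring] at h

lemma tendsto_gaussPrimitive_atBot :
    Tendsto gaussPrimitive atBot (𝓝 (-(√(2 * Real.pi) / 2))) := by
  have h := (tendsto_gaussPrimitive_atTop.comp tendsto_neg_atBot_atTop).neg
  refine h.congr fun x ↦ ?_
  simp [gaussPrimitive_neg]

lemma hasDerivAt_linear_div_sqrt (c z : ℝ) {u : ℝ} (hu : 0 < u) :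
    HasDerivAt (fun u ↦ (c * u + z) / √u) (c / (2 * √u) - z / (2 * u * √u)) u := by
  have h1 : HasDerivAt (fun u : ℝ ↦ c * u + z) c u := by
    simpa using ((hasDerivAt_id u).const_mul c).add_const z
  have hs : √u ≠ 0 := (Real.sqrt_pos.2 hu).ne'
  have h2 : √u ^ 2 = u := Real.sq_sqrt hu.le
  refine (h1.div (Real.hasDerivAt_sqrt hu.ne') hs).congr_deriv ?_
  field_simp
  rw [h2]
  field_simp
  ring

lemma tendsto_linear_div_sqrt_atTop {c : ℝ} (hc : 0 < c) (z : ℝ) :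
    Tendsto (fun u ↦ (c * u + z) / √u) atTop atTop := by
  have h1 : Tendsto (fun u : ℝ ↦ c * √u + z * (√u)⁻¹) atTop atTop :=
    (Real.tendsto_sqrt_atTop.const_mul_atTop hc).atTop_add
      ((tendsto_inv_atTop_zero.comp Real.tendsto_sqrt_atTop).const_mul z)
  refine h1.congr' ?_
  filter_upwards [eventually_gt_atTop 0] with u hu
  have h2 : √u ^ 2 = u := Real.sq_sqrt hu.le
  have hs : √u ≠ 0 := (Real.sqrt_pos.2 hu).ne'
  field_simp
  rw [h2]

lemma tendsto_inv_sqrt_nhdsGT_zero : Tendsto (fun u : ℝ ↦ (√u)⁻¹) (𝓝[>] 0) atTop := by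
  refine tendsto_inv_nhdsGT_zero.comp ?_
  refine tendsto_nhdsWithin_iff.2 ⟨?_, ?_⟩
  · have := Real.continuous_sqrt.tendsto 0
    rw [Real.sqrt_zero] at this
    exact this.mono_left nhdsWithin_le_nhds
  · filter_upwards [self_mem_nhdsWithin] with u hu using Real.sqrt_pos.2 hu

lemma tendsto_linear_nhdsGT_zero (c z : ℝ) :
    Tendsto (fun u : ℝ ↦ c * u + z) (𝓝[>] 0) (𝓝 z) := by
  have : Tendsto (fun u : ℝ ↦ c * u + z) (𝓝 0) (𝓝 (c * 0 + z)) :=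
    (by fun_prop : Continuous fun u : ℝ ↦ c * u + z).tendsto 0
  rw [mul_zero, zero_add] at this
  exact this.mono_left nhdsWithin_le_nhds

lemma tendsto_linear_div_sqrt_of_pos (c : ℝ) {z : ℝ} (hz : 0 < z) :
    Tendsto (fun u ↦ (c * u + z) / √u) (𝓝[>] 0) atTop :=
  (tendsto_linear_nhdsGT_zero c z).pos_mul_atTop hz tendsto_inv_sqrt_nhdsGT_zero

lemma tendsto_linear_div_sqrt_of_neg (c : ℝ) {z : ℝ} (hz : z < 0) :
    Tendsto (fun u ↦ (c * u + z) / √u) (𝓝[>] 0) atBot :=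
  (tendsto_linear_nhdsGT_zero c z).neg_mul_atTop hz tendsto_inv_sqrt_nhdsGT_zero

lemma tendsto_linear_div_sqrt_zero (c : ℝ) :
    Tendsto (fun u ↦ (c * u + 0) / √u) (𝓝[>] 0) (𝓝 0) := by
  have h : Tendsto (fun u : ℝ ↦ c * √u) (𝓝 0) (𝓝 (c * √0)) :=
    (by fun_prop : Continuous fun u : ℝ ↦ c * √u).tendsto 0
  rw [Real.sqrt_zero, mul_zero] at h
  refine (h.mono_left nhdsWithin_le_nhds).congr' ?_
  filter_upwards [self_mem_nhdsWithin] with u hu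
  rw [add_zero, mul_div_assoc, Real.div_sqrt]

/-- The density at `-z` of the total occupation measure of Brownian motion with drift `-c`. -/
noncomputable def driftPotential (c z : ℝ) : ℝ := |c|⁻¹ * Real.exp (-(c * z) - |c * z|)

lemma driftPotential_nonneg (c z : ℝ) : 0 ≤ driftPotential c z := by
  unfold driftPotential; positivity

lemma driftPotential_le (c z : ℝ) : driftPotential c z ≤ |c|⁻¹ := by
  unfold driftPotential
  refine mul_le_of_le_one_right (by positivity) (Real.exp_le_one_iff.2 ?_)
  linarith [neg_abs_le (c * z)]

lemma continuous_driftPotential (c : ℝ) : Continuous (driftPotential c) := by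
  unfold driftPotential; fun_prop

/-- A primitive of `u ↦ p_u (c u + z)`, where `p_u` is the centred Gaussian density of
variance `u`. -/
noncomputable def driftPrimitive (c z u : ℝ) : ℝ :=
  (c * √(2 * Real.pi))⁻¹ * (gaussPrimitive ((c * u + z) / √u) +
    Real.exp (-(2 * c * z)) * gaussPrimitive ((c * u + -z) / √u))

/-- Since `(cu - z)² + 4cuz = (cu + z)²`, the factor `exp(-2cz)` gives both terms the same Gaussian
exponential. The `z` parts of the inner derivatives then cancel and the `c` parts add up. -/
lemma hasDerivAt_driftPrimitive {c : ℝ} (hc : 0 < c) (z : ℝ) {u : ℝ} (hu : 0 < u) :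
    HasDerivAt (driftPrimitive c z) (gaussianPDFReal 0 u.toNNReal (c * u + z)) u := by
  have h1 := (hasDerivAt_gaussPrimitive _).comp u (hasDerivAt_linear_div_sqrt c z hu)
  have h2 := (hasDerivAt_gaussPrimitive _).comp u (hasDerivAt_linear_div_sqrt c (-z) hu)
  have h3 := (h1.add (h2.const_mul (Real.exp (-(2 * c * z))))).const_mul (c * √(2 * Real.pi))⁻¹
  refine h3.congr_deriv ?_
  have hsq : √u ^ 2 = u := Real.sq_sqrt hu.le
  have hs : √u ≠ 0 := (Real.sqrt_pos.2 hu).ne'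
  have e1 : Real.exp (-(2 * c * z)) * (Real.exp (-(1 / 2) * ((c * u + -z) / √u) ^ 2) *
      (c / (2 * √u) - -z / (2 * u * √u))) = Real.exp (-(1 / 2) * ((c * u + z) / √u) ^ 2) *
      (c / (2 * √u) + z / (2 * u * √u)) := by
    rw [← mul_assoc, ← Real.exp_add]
    congr 2
    · rw [div_pow, div_pow, hsq]
      field_simp
      ring
    · ring
  rw [e1, gaussianPDFReal, Real.coe_toNNReal _ hu.le, div_pow, hsq,
    Real.sqrt_mul (by positivity) u]
  have e2 : -(1 / 2) * ((c * u + z) ^ 2 / u) = -(c * u + z - 0) ^ 2 / (2 * u) := by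
    field_simp
    ring
  rw [e2]
  field_simp
  ring

lemma tendsto_driftPrimitive_atTop {c : ℝ} (hc : 0 < c) (z : ℝ) :
    Tendsto (driftPrimitive c z) atTop (𝓝 ((2 * c)⁻¹ * (1 + Real.exp (-(2 * c * z))))) := by
  have h := (((tendsto_gaussPrimitive_atTop.comp (tendsto_linear_div_sqrt_atTop hc z)).add
    ((tendsto_gaussPrimitive_atTop.comp (tendsto_linear_div_sqrt_atTop hc (-z))).const_mul
      (Real.exp (-(2 * c * z))))).const_mul (c * √(2 * Real.pi))⁻¹)
  have hpi : √(2 * Real.pi) ≠ 0 := by positivity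
  convert h using 2
  · rfl
  field_simp

/-- The limit depends on the sign of `z`, because `±z / √u` tends to `±∞` or stays `0`. It is
written as the limit at infinity minus `driftPotential`, so that the difference of the two limits is
the desired integral. -/
lemma tendsto_driftPrimitive_zero {c : ℝ} (hc : 0 < c) (z : ℝ) :
    Tendsto (driftPrimitive c z) (𝓝[>] 0)
      (𝓝 ((2 * c)⁻¹ * (1 + Real.exp (-(2 * c * z))) - driftPotential c z)) := by
  have hpi : √(2 * Real.pi) ≠ 0 := by positivity
  rcases lt_trichotomy z 0 with hz | rfl | hz
  · have h := (((tendsto_gaussPrimitive_atBot.comp (tendsto_linear_div_sqrt_of_neg c hz)).add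
      ((tendsto_gaussPrimitive_atTop.comp
        (tendsto_linear_div_sqrt_of_pos c (neg_pos.2 hz))).const_mul
        (Real.exp (-(2 * c * z))))).const_mul (c * √(2 * Real.pi))⁻¹)
    convert h using 2
    · rfl
    rw [driftPotential, abs_of_pos hc, abs_of_neg (mul_neg_of_pos_of_neg hc hz)]
    simp only [sub_neg_eq_add, neg_add_cancel, Real.exp_zero]
    field_simp
    ring
  · have h0 : Tendsto gaussPrimitive (𝓝 0) (𝓝 0) := by
      have := (hasDerivAt_gaussPrimitive 0).continuousAt.tendsto
      simpa [gaussPrimitive] using this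
    have h1 := h0.comp (tendsto_linear_div_sqrt_zero c)
    have h := ((h1.add (h1.const_mul (Real.exp (-(2 * c * 0))))).const_mul
      (c * √(2 * Real.pi))⁻¹)
    have h' : Tendsto (driftPrimitive c 0) (𝓝[>] 0) _ := h.congr fun u ↦ by simp [driftPrimitive]
    convert h' using 2
    rw [driftPotential, abs_of_pos hc]
    simp
    field_simp
    ring
  · have h := (((tendsto_gaussPrimitive_atTop.comp (tendsto_linear_div_sqrt_of_pos c hz)).add
      ((tendsto_gaussPrimitive_atBot.comp
        (tendsto_linear_div_sqrt_of_neg c (neg_lt_zero.2 hz))).const_mul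
        (Real.exp (-(2 * c * z))))).const_mul (c * √(2 * Real.pi))⁻¹)
    convert h using 2
    · rfl
    rw [driftPotential, abs_of_pos hc, abs_of_pos (mul_pos hc hz),
      show -(c * z) - c * z = -(2 * c * z) by ring]
    field_simp
    ring

lemma gaussianPDF_zero_neg (v : ℝ≥0) (x : ℝ) : gaussianPDF 0 v (-x) = gaussianPDF 0 v x := by
  simp [gaussianPDF, gaussianPDFReal]

lemma lintegral_gaussianPDF_linear_of_pos {c : ℝ} (hc : 0 < c) (z : ℝ) :
    ∫⁻ u in Set.Ioi (0 : ℝ), gaussianPDF 0 u.toNNReal (c * u + z) =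
      ENNReal.ofReal (driftPotential c z) := by
  set m := (2 * c)⁻¹ * (1 + Real.exp (-(2 * c * z))) - driftPotential c z
  -- At `u = 0` division by `√0` gives `driftPrimitive` a junk value; it is replaced by the right
  -- limit so that the fundamental theorem applies on `[0, ∞)`.
  set F := Function.update (driftPrimitive c z) 0 m with hF
  have hcont : ContinuousWithinAt F (Set.Ici 0) 0 := by
    rw [hF, continuousWithinAt_update_same, (by ext; grind : Set.Ici (0 : ℝ) \ {0} = Set.Ioi 0)]
    exact tendsto_driftPrimitive_zero hc z
  have hderiv : ∀ u ∈ Set.Ioi (0 : ℝ),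
      HasDerivAt F (gaussianPDFReal 0 u.toNNReal (c * u + z)) u := by
    intro u hu
    refine (hasDerivAt_driftPrimitive hc z hu).congr_of_eventuallyEq ?_
    filter_upwards [lt_mem_nhds hu] with v hv
    rw [hF, Function.update_of_ne hv.ne']
  have hpos : ∀ u ∈ Set.Ioi (0 : ℝ), 0 ≤ gaussianPDFReal 0 u.toNNReal (c * u + z) :=
    fun u _ ↦ gaussianPDFReal_nonneg _ _ _
  have hlim : Tendsto F atTop (𝓝 ((2 * c)⁻¹ * (1 + Real.exp (-(2 * c * z))))) := by
    refine (tendsto_driftPrimitive_atTop hc z).congr' ?_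
    filter_upwards [eventually_gt_atTop 0] with v hv
    rw [hF, Function.update_of_ne hv.ne']
  have hint := integrableOn_Ioi_deriv_of_nonneg hcont hderiv hpos hlim
  have hval := integral_Ioi_of_hasDerivAt_of_tendsto hcont hderiv hint hlim
  simp only [gaussianPDF]
  rw [← ofReal_integral_eq_lintegral_ofReal hint
    (ae_of_all _ fun u ↦ gaussianPDFReal_nonneg _ _ _), hval, hF, Function.update_self]
  congr 1
  ring

/-- `∫₀^∞ p_u (c u + z) du`, where `p_u` is the centred Gaussian density of variance `u`. -/
lemma lintegral_gaussianPDF_linear {c : ℝ} (hc : c ≠ 0) (z : ℝ) :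
    ∫⁻ u in Set.Ioi (0 : ℝ), gaussianPDF 0 u.toNNReal (c * u + z) =
      ENNReal.ofReal (driftPotential c z) := by
  rcases hc.lt_or_gt with hc | hc
  · have h := lintegral_gaussianPDF_linear_of_pos (neg_pos.2 hc) (-z)
    rw [driftPotential, abs_neg, neg_mul_neg, ← driftPotential] at h
    rw [← h]
    refine lintegral_congr fun u ↦ ?_
    rw [← gaussianPDF_zero_neg]
    congr 1
    ring
  · exact lintegral_gaussianPDF_linear_of_pos hc z

/-! ### Moments of occupation times along rays -/

/-- The integral of `f (X t ω - b t)` over all times `t > 0`. -/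
noncomputable def rayOccupation {Ω : Type*} (X : ℝ≥0 → Ω → ℝ) (f : ℝ → ℝ≥0∞) (b : ℝ) (ω : Ω) :
    ℝ≥0∞ :=
  ∫⁻ t in Set.Ioi (0 : ℝ), f (X t.toNNReal ω - b * t)

/-- The density of the joint occupation measure at `(b s + x, c t + y)`, integrated over all times
`0 < s < t`. -/
noncomputable def rayKernel (b c x y : ℝ) : ℝ≥0∞ :=
  ∫⁻ s in Set.Ioi (0 : ℝ), gaussianPDF 0 s.toNNReal (b * s + x) *
    ENNReal.ofReal (driftPotential c ((c - b) * s + y - x))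

lemma Measurable.gaussianPDF_zero {α : Type*} [MeasurableSpace α] {v : α → ℝ≥0} {x : α → ℝ}
    (hv : Measurable v) (hx : Measurable x) : Measurable fun a ↦ gaussianPDF 0 (v a) (x a) :=
  measurable_uncurry_gaussianPDF.comp (measurable_const.prodMk (hv.prodMk hx))

lemma lintegral_gaussianReal {v : ℝ≥0} (hv : v ≠ 0) {f : ℝ → ℝ≥0∞} (hf : Measurable f) :
    ∫⁻ x, f x ∂(gaussianReal 0 v) = ∫⁻ x, f x * gaussianPDF 0 v x := by
  rw [gaussianReal_of_var_ne_zero _ hv,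
    lintegral_withDensity_eq_lintegral_mul _ (measurable_gaussianPDF _ _) hf]
  simp [mul_comm]

lemma setLIntegral_Ioi_eq_add (f : ℝ → ℝ≥0∞) (s : ℝ) :
    ∫⁻ t in Set.Ioi s, f t = ∫⁻ u in Set.Ioi (0 : ℝ), f (s + u) := by
  rw [← lintegral_indicator measurableSet_Ioi, ← lintegral_indicator measurableSet_Ioi,
    ← lintegral_add_left_eq_self _ s]
  refine lintegral_congr fun u ↦ ?_
  simp [Set.indicator]

section Moments

variable {Ω : Type*} [MeasurableSpace Ω] {P : Measure Ω} {X : ℝ≥0 → Ω → ℝ}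

lemma ProbabilityTheory.IsPreBrownianReal.lintegral_comp_sub (hX : IsPreBrownianReal X P)
    {f : ℝ → ℝ≥0∞} (hf : Measurable f) (b : ℝ) {t : ℝ} (ht : 0 < t) :
    ∫⁻ ω, f (X t.toNNReal ω - b * t) ∂P =
      ∫⁻ x, f x * gaussianPDF 0 t.toNNReal (b * t + x) := by
  have hv : t.toNNReal ≠ 0 := (Real.toNNReal_pos.2 ht).ne'
  have hg : Measurable fun x ↦ f (x - b * t) := by fun_prop
  rw [← lintegral_map' hg.aemeasurable (hX.aemeasurable t.toNNReal),
    (hX.hasLaw_eval t.toNNReal).map_eq, lintegral_gaussianReal hv hg,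
    ← lintegral_add_left_eq_self _ (b * t)]
  simp

/-- `X s` and `X (s + u) - X s` are independent Gaussians. With `x` and `y` the deviations from the
two rays, the increment from `bs + x` to `c(s + u) + y` is `cu + ((c - b)s + y - x)`. -/
lemma ProbabilityTheory.IsPreBrownianReal.lintegral_comp_sub_mul (hX : IsPreBrownianReal X P)
    {f g : ℝ → ℝ≥0∞} (hf : Measurable f) (hg : Measurable g) (b c : ℝ) {s u : ℝ} (hs : 0 < s)
    (hu : 0 < u) :
    ∫⁻ ω, f (X s.toNNReal ω - b * s) * g (X (s + u).toNNReal ω - c * (s + u)) ∂P =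
      ∫⁻ x, ∫⁻ y, f x * g y * (gaussianPDF 0 s.toNNReal (b * s + x) *
        gaussianPDF 0 u.toNNReal (c * u + ((c - b) * s + y - x))) := by
  have := hX.isGaussianProcess.isProbabilityMeasure
  have hvs : s.toNNReal ≠ 0 := (Real.toNNReal_pos.2 hs).ne'
  have hvu : u.toNNReal ≠ 0 := (Real.toNNReal_pos.2 hu).ne'
  have hsu : (s + u).toNNReal = s.toNNReal + u.toNNReal := Real.toNNReal_add hs.le hu.le
  have hind : IndepFun (X s.toNNReal) (X (s + u).toNNReal - X s.toNNReal) P :=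
    hX.hasIndepIncrements.indepFun_eval_sub zero_le (by simp [hsu]) hX.eval_zero_ae_eq_zero
  have hmap := hind.map_prod_eq_prod_map_map (hX.aemeasurable _)
    ((hX.aemeasurable _).sub (hX.aemeasurable _))
  have hlaw : P.map (X (s + u).toNNReal - X s.toNNReal) = gaussianReal 0 u.toNNReal := by
    rw [(hX.hasLaw_sub _ _).map_eq]
    congr 1
    ext
    simp [hu.le, hs.le]
  rw [(hX.hasLaw_eval _).map_eq, hlaw] at hmap
  have hF : Measurable fun p : ℝ × ℝ ↦ f (p.1 - b * s) * g (p.1 + p.2 - c * (s + u)) := by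
    fun_prop
  have h1 : ∫⁻ ω, f (X s.toNNReal ω - b * s) * g (X (s + u).toNNReal ω - c * (s + u)) ∂P =
      ∫⁻ p, f (p.1 - b * s) * g (p.1 + p.2 - c * (s + u))
        ∂((gaussianReal 0 s.toNNReal).prod (gaussianReal 0 u.toNNReal)) := by
    rw [← hmap, lintegral_map' hF.aemeasurable ((hX.aemeasurable _).prodMk
      ((hX.aemeasurable _).sub (hX.aemeasurable _)))]
    simp
  rw [h1, lintegral_prod _ hF.aemeasurable, lintegral_gaussianReal hvs hF.lintegral_prod_right',
    ← lintegral_add_left_eq_self _ (b * s)]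
  refine lintegral_congr fun x ↦ ?_
  rw [lintegral_gaussianReal hvu (by fun_prop), ← lintegral_mul_const _ (by
      refine Measurable.fun_mul (by fun_prop) (measurable_gaussianPDF _ _)),
    ← lintegral_add_left_eq_self _ (c * u + (c - b) * s - x)]
  refine lintegral_congr fun y ↦ ?_
  rw [show b * s + x - b * s = x by ring,
    show b * s + x + (c * u + (c - b) * s - x + y) - c * (s + u) = y by ring,
    show c * u + (c - b) * s - x + y = c * u + ((c - b) * s + y - x) by ring]
  ring

lemma measurable_integrand (hm : Measurable (Function.uncurry X)) {f : ℝ → ℝ≥0∞}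
    (hf : Measurable f) (b : ℝ) :
    Measurable fun p : Ω × ℝ ↦ f (X p.2.toNNReal p.1 - b * p.2) := by
  have : Measurable fun p : Ω × ℝ ↦ X p.2.toNNReal p.1 :=
    hm.comp (measurable_snd.real_toNNReal.prodMk measurable_fst)
  fun_prop

lemma measurable_rayOccupation (hm : Measurable (Function.uncurry X)) {f : ℝ → ℝ≥0∞}
    (hf : Measurable f) (b : ℝ) : Measurable (rayOccupation X f b) :=
  (measurable_integrand hm hf b).lintegral_prod_right'

lemma lintegral_rayOccupation [SFinite P] (hX : IsPreBrownianReal X P)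
    (hm : Measurable (Function.uncurry X)) {f : ℝ → ℝ≥0∞} (hf : Measurable f) {b : ℝ}
    (hb : b ≠ 0) :
    ∫⁻ ω, rayOccupation X f b ω ∂P = ∫⁻ x, f x * ENNReal.ofReal (driftPotential b x) := by
  unfold rayOccupation
  rw [lintegral_lintegral_swap (measurable_integrand hm hf b).aemeasurable,
    setLIntegral_congr_fun measurableSet_Ioi fun t ht ↦ hX.lintegral_comp_sub hf b ht,
    lintegral_lintegral_swap]
  · refine lintegral_congr fun x ↦ ?_
    rw [lintegral_const_mul _ (by
      exact Measurable.gaussianPDF_zero (by fun_prop) (by fun_prop)),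
      lintegral_gaussianPDF_linear hb]
  · refine Measurable.aemeasurable (Measurable.fun_mul (by fun_prop) ?_)
    exact Measurable.gaussianPDF_zero (by fun_prop) (by fun_prop)

/-- The part of the second moment of the occupation times coming from the times `s < t`. -/
lemma lintegral_ordered_times [SFinite P] (hX : IsPreBrownianReal X P)
    {f g : ℝ → ℝ≥0∞} (hf : Measurable f) (hg : Measurable g) (b : ℝ) {c : ℝ} (hc : c ≠ 0) :
    ∫⁻ s in Set.Ioi (0 : ℝ), ∫⁻ t in Set.Ioi s,
      ∫⁻ ω, f (X s.toNNReal ω - b * s) * g (X t.toNNReal ω - c * t) ∂P =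
      ∫⁻ x, ∫⁻ y, f x * g y * rayKernel b c x y := by
  have hk : Measurable fun p : ((ℝ × ℝ) × ℝ) × ℝ ↦ f p.1.2 * g p.2 *
      (gaussianPDF 0 p.1.1.1.toNNReal (b * p.1.1.1 + p.1.2) *
        gaussianPDF 0 p.1.1.2.toNNReal (c * p.1.1.2 + ((c - b) * p.1.1.1 + p.2 - p.1.2))) := by
    refine Measurable.fun_mul (by fun_prop) (Measurable.fun_mul ?_ ?_)
    all_goals exact Measurable.gaussianPDF_zero (by fun_prop) (by fun_prop)
  calc
    _ = ∫⁻ s in Set.Ioi (0 : ℝ), ∫⁻ u in Set.Ioi (0 : ℝ), ∫⁻ x, ∫⁻ y, f x * g y *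
          (gaussianPDF 0 s.toNNReal (b * s + x) *
          gaussianPDF 0 u.toNNReal (c * u + ((c - b) * s + y - x))) := by
      refine setLIntegral_congr_fun measurableSet_Ioi fun s hs ↦ ?_
      rw [setLIntegral_Ioi_eq_add]
      exact setLIntegral_congr_fun measurableSet_Ioi fun u hu ↦
        hX.lintegral_comp_sub_mul hf hg b c hs hu
    -- Only the increment density depends on `u`; its integral is the potential density for slope
    -- `c`.
    _ = ∫⁻ s in Set.Ioi (0 : ℝ), ∫⁻ x, ∫⁻ y, f x * g y *
          (gaussianPDF 0 s.toNNReal (b * s + x) *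
          ENNReal.ofReal (driftPotential c ((c - b) * s + y - x))) := by
      refine lintegral_congr fun s ↦ ?_
      rw [lintegral_lintegral_swap]
      · refine lintegral_congr fun x ↦ ?_
        rw [lintegral_lintegral_swap]
        · refine lintegral_congr fun y ↦ ?_
          rw [lintegral_const_mul, lintegral_const_mul, lintegral_gaussianPDF_linear hc]
          · exact Measurable.gaussianPDF_zero (by fun_prop) (by fun_prop)
          · refine Measurable.fun_mul (by fun_prop) ?_
            exact Measurable.gaussianPDF_zero (by fun_prop) (by fun_prop)
        · exact (hk.comp (f := fun q : ℝ × ℝ ↦ (((s, q.1), x), q.2)) (by fun_prop)).aemeasurable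
      · exact (hk.comp (f := fun q : (ℝ × ℝ) × ℝ ↦ (((s, q.1.1), q.1.2), q.2))
          (by fun_prop)).lintegral_prod_right'.aemeasurable
    _ = _ := by
      have hk' : Measurable fun p : (ℝ × ℝ) × ℝ ↦ f p.1.2 * g p.2 *
          (gaussianPDF 0 p.1.1.toNNReal (b * p.1.1 + p.1.2) *
          ENNReal.ofReal (driftPotential c ((c - b) * p.1.1 + p.2 - p.1.2))) := by
        refine Measurable.fun_mul (by fun_prop) (Measurable.fun_mul ?_ ?_)
        · exact Measurable.gaussianPDF_zero (by fun_prop) (by fun_prop)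
        · exact ((continuous_driftPotential c).measurable.comp (by fun_prop)).ennreal_ofReal
      rw [lintegral_lintegral_swap hk'.lintegral_prod_right'.aemeasurable]
      refine lintegral_congr fun x ↦ ?_
      rw [lintegral_lintegral_swap]
      · refine lintegral_congr fun y ↦ ?_
        rw [lintegral_const_mul, rayKernel]
        refine Measurable.fun_mul ?_ ?_
        · exact Measurable.gaussianPDF_zero (by fun_prop) (by fun_prop)
        · exact ((continuous_driftPotential c).measurable.comp (by fun_prop)).ennreal_ofReal
      · exact (hk'.comp (f := fun q : ℝ × ℝ ↦ ((q.1, x), q.2)) (by fun_prop)).aemeasurable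

lemma lintegral_Ioi_split (φ : ℝ → ℝ → ℝ≥0∞) (hφ : Measurable (Function.uncurry φ)) :
    ∫⁻ s in Set.Ioi (0 : ℝ), ∫⁻ t in Set.Ioi (0 : ℝ), φ s t =
      (∫⁻ s in Set.Ioi (0 : ℝ), ∫⁻ t in Set.Ioi s, φ s t) +
        ∫⁻ t in Set.Ioi (0 : ℝ), ∫⁻ s in Set.Ioi t, φ s t := by
  have hA : Measurable fun p : ℝ × ℝ ↦ {q : ℝ × ℝ | q.1 < q.2}.indicator (Function.uncurry φ) p :=
    hφ.indicator (measurableSet_lt measurable_fst measurable_snd)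
  have hB : Measurable fun p : ℝ × ℝ ↦ {q : ℝ × ℝ | q.2 < q.1}.indicator (Function.uncurry φ) p :=
    hφ.indicator (measurableSet_lt measurable_snd measurable_fst)
  have e1 : ∫⁻ s in Set.Ioi (0 : ℝ), ∫⁻ t in Set.Ioi s, φ s t =
      ∫⁻ s in Set.Ioi (0 : ℝ), ∫⁻ t in Set.Ioi (0 : ℝ),
        {q : ℝ × ℝ | q.1 < q.2}.indicator (Function.uncurry φ) (s, t) := by
    refine setLIntegral_congr_fun measurableSet_Ioi fun s (hs : 0 < s) ↦ ?_
    rw [← lintegral_indicator measurableSet_Ioi, ← lintegral_indicator measurableSet_Ioi]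
    refine lintegral_congr fun t ↦ ?_
    simp only [Set.indicator, Set.mem_Ioi, Set.mem_ofPred_eq, Function.uncurry]
    grind
  have e2 : ∫⁻ t in Set.Ioi (0 : ℝ), ∫⁻ s in Set.Ioi t, φ s t =
      ∫⁻ t in Set.Ioi (0 : ℝ), ∫⁻ s in Set.Ioi (0 : ℝ),
        {q : ℝ × ℝ | q.2 < q.1}.indicator (Function.uncurry φ) (s, t) := by
    refine setLIntegral_congr_fun measurableSet_Ioi fun t (ht : 0 < t) ↦ ?_
    rw [← lintegral_indicator measurableSet_Ioi, ← lintegral_indicator measurableSet_Ioi]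
    refine lintegral_congr fun s ↦ ?_
    simp only [Set.indicator, Set.mem_Ioi, Set.mem_ofPred_eq, Function.uncurry]
    grind
  rw [e1, e2, lintegral_lintegral_swap (f := fun t s ↦
      {q : ℝ × ℝ | q.2 < q.1}.indicator (Function.uncurry φ) (s, t))
      (hB.comp measurable_swap).aemeasurable,
    ← lintegral_add_left hA.lintegral_prod_right']
  refine lintegral_congr fun s ↦ ?_
  have hA' : Measurable fun t ↦ {q : ℝ × ℝ | q.1 < q.2}.indicator (Function.uncurry φ) (s, t) :=
    hA.comp measurable_prodMk_left
  rw [← lintegral_add_left hA']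
  refine lintegral_congr_ae (ae_restrict_of_ae ?_)
  -- The diagonal `t = s`, missed by both halves, is null for each fixed `s`.
  filter_upwards [compl_mem_ae_iff.2 (measure_singleton s)] with t ht
  have : t ≠ s := ht
  simp only [Set.indicator, Set.mem_ofPred_eq, Function.uncurry]
  rcases lt_or_gt_of_ne this with h | h <;> simp [h, h.not_gt]

/-- The second moments of the occupation times. -/
lemma lintegral_rayOccupation_mul [SFinite P] (hX : IsPreBrownianReal X P)
    (hm : Measurable (Function.uncurry X)) {f g : ℝ → ℝ≥0∞} (hf : Measurable f)
    (hg : Measurable g) {b c : ℝ} (hb : b ≠ 0) (hc : c ≠ 0) :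
    ∫⁻ ω, rayOccupation X f b ω * rayOccupation X g c ω ∂P =
      (∫⁻ x, ∫⁻ y, f x * g y * rayKernel b c x y) +
        ∫⁻ x, ∫⁻ y, g x * f y * rayKernel c b x y := by
  have hfm := measurable_integrand hm hf b
  have hgm := measurable_integrand hm hg c
  have hk : Measurable fun p : (ℝ × ℝ) × Ω ↦
      f (X p.1.1.toNNReal p.2 - b * p.1.1) * g (X p.1.2.toNNReal p.2 - c * p.1.2) :=
    Measurable.fun_mul (hfm.comp (f := fun p : (ℝ × ℝ) × Ω ↦ (p.2, p.1.1)) (by fun_prop))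
      (hgm.comp (f := fun p : (ℝ × ℝ) × Ω ↦ (p.2, p.1.2)) (by fun_prop))
  have e1 : ∫⁻ ω, rayOccupation X f b ω * rayOccupation X g c ω ∂P =
      ∫⁻ s in Set.Ioi (0 : ℝ), ∫⁻ t in Set.Ioi (0 : ℝ),
        ∫⁻ ω, f (X s.toNNReal ω - b * s) * g (X t.toNNReal ω - c * t) ∂P := by
    have h1 : ∀ ω, rayOccupation X f b ω * rayOccupation X g c ω =
        ∫⁻ s in Set.Ioi (0 : ℝ), ∫⁻ t in Set.Ioi (0 : ℝ),
          f (X s.toNNReal ω - b * s) * g (X t.toNNReal ω - c * t) := fun ω ↦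
      (lintegral_lintegral_mul (hfm.comp measurable_prodMk_left).aemeasurable
        (hgm.comp measurable_prodMk_left).aemeasurable).symm
    simp_rw [h1]
    rw [lintegral_lintegral_swap]
    · refine lintegral_congr fun s ↦ ?_
      rw [lintegral_lintegral_swap]
      exact (hk.comp (f := fun q : Ω × ℝ ↦ ((s, q.2), q.1)) (by fun_prop)).aemeasurable
    · exact (hk.comp (f := fun q : (Ω × ℝ) × ℝ ↦ ((q.1.2, q.2), q.1.1))
        (by fun_prop)).lintegral_prod_right'.aemeasurable
  rw [e1, lintegral_Ioi_split (fun s t ↦ ∫⁻ ω, f (X s.toNNReal ω - b * s) *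
      g (X t.toNNReal ω - c * t) ∂P) hk.lintegral_prod_right', lintegral_ordered_times hX hf hg b hc,
    ← lintegral_ordered_times hX hg hf c hb]
  simp_rw [mul_comm]

end Moments

/-! ### The kernel near and at the origin -/

/-- Expanding the square leaves the factor `exp(-bx - x²/(2s))`, at most `exp |b|` uniformly in `s`.
This supplies the dominating function for continuity of the kernel. -/
lemma gaussianPDFReal_linear_le (b : ℝ) {x : ℝ} (hx : |x| ≤ 1) {s : ℝ} (hs : 0 < s) :
    gaussianPDFReal 0 s.toNNReal (b * s + x) ≤
      Real.exp |b| * gaussianPDFReal 0 s.toNNReal (b * s + 0) := by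
  have hbx : -|b| ≤ b * x := by
    have := abs_mul b x
    have h2 : |b| * |x| ≤ |b| := mul_le_of_le_one_right (abs_nonneg b) hx
    linarith [neg_abs_le (b * x)]
  have hexp : Real.exp (-(b * s + x - 0) ^ 2 / (2 * s)) ≤
      Real.exp |b| * Real.exp (-(b * s + 0 - 0) ^ 2 / (2 * s)) := by
    rw [← Real.exp_add, Real.exp_le_exp, ← sub_nonneg]
    have : |b| + -(b * s + 0 - 0) ^ 2 / (2 * s) - -(b * s + x - 0) ^ 2 / (2 * s) =
        (|b| + b * x) + x ^ 2 / (2 * s) := by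
      field_simp
      ring
    rw [this]
    have : 0 ≤ x ^ 2 / (2 * s) := by positivity
    linarith
  rw [gaussianPDFReal, gaussianPDFReal, Real.coe_toNNReal _ hs.le, mul_left_comm]
  gcongr

lemma continuous_gaussianPDF (m : ℝ) (v : ℝ≥0) : Continuous (gaussianPDF m v) := by
  refine ENNReal.continuous_ofReal.comp ?_
  unfold gaussianPDFReal
  fun_prop

lemma measurable_rayKernel_integrand (b c : ℝ) : Measurable fun p : (ℝ × ℝ) × ℝ ↦
    gaussianPDF 0 p.2.toNNReal (b * p.2 + p.1.1) *
      ENNReal.ofReal (driftPotential c ((c - b) * p.2 + p.1.2 - p.1.1)) := by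
  refine Measurable.fun_mul ?_ ?_
  · exact Measurable.gaussianPDF_zero (by fun_prop) (by fun_prop)
  · exact ((continuous_driftPotential c).measurable.comp (by fun_prop)).ennreal_ofReal

lemma measurable_rayKernel (b c : ℝ) : Measurable fun p : ℝ × ℝ ↦ rayKernel b c p.1 p.2 :=
  (measurable_rayKernel_integrand b c).lintegral_prod_right'

lemma rayKernel_le {b : ℝ} (hb : b ≠ 0) (c x y : ℝ) :
    rayKernel b c x y ≤ ENNReal.ofReal |b|⁻¹ * ENNReal.ofReal |c|⁻¹ := by
  calc
    _ ≤ ∫⁻ s in Set.Ioi (0 : ℝ), gaussianPDF 0 s.toNNReal (b * s + x) * ENNReal.ofReal |c|⁻¹ := by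
      refine lintegral_mono fun s ↦ ?_
      gcongr
      exact driftPotential_le _ _
    _ = ENNReal.ofReal (driftPotential b x) * ENNReal.ofReal |c|⁻¹ := by
      rw [lintegral_mul_const' _ _ ENNReal.ofReal_ne_top, lintegral_gaussianPDF_linear hb]
    _ ≤ _ := by
      gcongr
      exact driftPotential_le _ _

lemma continuousAt_rayKernel {b : ℝ} (hb : b ≠ 0) (c : ℝ) :
    ContinuousAt (fun p : ℝ × ℝ ↦ rayKernel b c p.1 p.2) (0, 0) := by
  have h1 : ∀ᶠ p : ℝ × ℝ in 𝓝 (0, 0), |p.1| < 1 := by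
    have : Tendsto (fun p : ℝ × ℝ ↦ |p.1|) (𝓝 (0, 0)) (𝓝 |(0 : ℝ)|) :=
      (by fun_prop : Continuous fun p : ℝ × ℝ ↦ |p.1|).tendsto (0, 0)
    exact this.eventually_lt_const (by simp)
  have hbound : ∀ᶠ p : ℝ × ℝ in 𝓝 (0, 0), ∀ᵐ s ∂(volume.restrict (Set.Ioi (0 : ℝ))),
      gaussianPDF 0 s.toNNReal (b * s + p.1) *
        ENNReal.ofReal (driftPotential c ((c - b) * s + p.2 - p.1)) ≤
      ENNReal.ofReal (Real.exp |b|) * gaussianPDF 0 s.toNNReal (b * s + 0) *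
        ENNReal.ofReal |c|⁻¹ := by
    filter_upwards [h1] with p hp
    filter_upwards [ae_restrict_mem measurableSet_Ioi] with s hs
    refine mul_le_mul' ?_ (ENNReal.ofReal_le_ofReal (driftPotential_le _ _))
    rw [gaussianPDF, gaussianPDF, ← ENNReal.ofReal_mul (Real.exp_pos _).le]
    exact ENNReal.ofReal_le_ofReal (gaussianPDFReal_linear_le b hp.le hs)
  have hfin : ∫⁻ s in Set.Ioi (0 : ℝ), ENNReal.ofReal (Real.exp |b|) *
      gaussianPDF 0 s.toNNReal (b * s + 0) * ENNReal.ofReal |c|⁻¹ ≠ ∞ := by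
    rw [lintegral_mul_const' _ _ ENNReal.ofReal_ne_top,
      lintegral_const_mul' _ _ ENNReal.ofReal_ne_top, lintegral_gaussianPDF_linear hb]
    finiteness
  have hlim : ∀ s : ℝ, Tendsto (fun p : ℝ × ℝ ↦ gaussianPDF 0 s.toNNReal (b * s + p.1) *
      ENNReal.ofReal (driftPotential c ((c - b) * s + p.2 - p.1))) (𝓝 (0, 0))
      (𝓝 (gaussianPDF 0 s.toNNReal (b * s + 0) *
        ENNReal.ofReal (driftPotential c ((c - b) * s + 0 - 0)))) := by
    intro s
    have hc1 : Continuous fun p : ℝ × ℝ ↦ gaussianPDF 0 s.toNNReal (b * s + p.1) :=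
      (continuous_gaussianPDF _ _).comp (by fun_prop)
    have hc2 : Continuous fun p : ℝ × ℝ ↦
        ENNReal.ofReal (driftPotential c ((c - b) * s + p.2 - p.1)) :=
      ENNReal.continuous_ofReal.comp ((continuous_driftPotential c).comp (by fun_prop))
    exact ENNReal.Tendsto.mul (hc1.tendsto (0, 0)) (Or.inr ENNReal.ofReal_ne_top)
      (hc2.tendsto (0, 0)) (Or.inr gaussianPDF_ne_top)
  have hmeas (p : ℝ × ℝ) : Measurable fun s : ℝ ↦ gaussianPDF 0 s.toNNReal (b * s + p.1) *
      ENNReal.ofReal (driftPotential c ((c - b) * s + p.2 - p.1)) := by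
    refine Measurable.fun_mul ?_ ?_
    · exact Measurable.gaussianPDF_zero (by fun_prop) (by fun_prop)
    · exact ((continuous_driftPotential c).measurable.comp (by fun_prop)).ennreal_ofReal
  exact tendsto_lintegral_filter_of_dominated_convergence _ (Eventually.of_forall hmeas) hbound
    hfin (ae_of_all _ hlim)

/-- Here the potential contributes `exp(-2c(c - b)s)`. As `b² + 4c(c - b) = (2c - b)²`, the
integrand is again a Gaussian density along a ray, of slope `2c - b`. -/
lemma rayKernel_zero_of_nonneg {b c : ℝ} (hb : b ≠ 0) (h : 0 ≤ c * (c - b)) :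
    rayKernel b c 0 0 = ENNReal.ofReal (|2 * c - b|⁻¹ * |c|⁻¹) := by
  have hne : 2 * c - b ≠ 0 := by
    intro h0
    have : 0 < b ^ 2 := by positivity
    nlinarith
  have hpt : ∀ s ∈ Set.Ioi (0 : ℝ), gaussianPDF 0 s.toNNReal (b * s + 0) *
      ENNReal.ofReal (driftPotential c ((c - b) * s + 0 - 0)) =
      gaussianPDF 0 s.toNNReal ((2 * c - b) * s + 0) * ENNReal.ofReal |c|⁻¹ := by
    intro s (hs : 0 < s)
    rw [gaussianPDF, gaussianPDF, ← ENNReal.ofReal_mul (gaussianPDFReal_nonneg _ _ _),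
      ← ENNReal.ofReal_mul (gaussianPDFReal_nonneg _ _ _), gaussianPDFReal, gaussianPDFReal,
      driftPotential, Real.coe_toNNReal _ hs.le,
      abs_of_nonneg (by nlinarith : 0 ≤ c * ((c - b) * s + 0 - 0))]
    congr 1
    have : Real.exp (-((2 * c - b) * s + 0 - 0) ^ 2 / (2 * s)) =
        Real.exp (-(b * s + 0 - 0) ^ 2 / (2 * s)) *
          Real.exp (-(c * ((c - b) * s + 0 - 0)) - c * ((c - b) * s + 0 - 0)) := by
      rw [← Real.exp_add]
      congr 1
      field_simp
      ring
    rw [this]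
    ring
  rw [rayKernel, setLIntegral_congr_fun measurableSet_Ioi hpt,
    lintegral_mul_const' _ _ ENNReal.ofReal_ne_top, lintegral_gaussianPDF_linear hne,
    ← ENNReal.ofReal_mul (driftPotential_nonneg _ _)]
  simp [driftPotential]

/-- Here the exponent `-cz - |cz|` vanishes, so the potential is the constant `|c|⁻¹`: from a point
of ray `b`, the path almost surely meets ray `c` later. -/
lemma rayKernel_zero_of_nonpos {b c : ℝ} (hb : b ≠ 0) (h : c * (c - b) ≤ 0) :
    rayKernel b c 0 0 = ENNReal.ofReal (|b|⁻¹ * |c|⁻¹) := by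
  have hpt : ∀ s ∈ Set.Ioi (0 : ℝ), gaussianPDF 0 s.toNNReal (b * s + 0) *
      ENNReal.ofReal (driftPotential c ((c - b) * s + 0 - 0)) =
      gaussianPDF 0 s.toNNReal (b * s + 0) * ENNReal.ofReal |c|⁻¹ := by
    intro s (hs : 0 < s)
    rw [driftPotential, abs_of_nonpos (by nlinarith : c * ((c - b) * s + 0 - 0) ≤ 0)]
    simp
  rw [rayKernel, setLIntegral_congr_fun measurableSet_Ioi hpt,
    lintegral_mul_const' _ _ ENNReal.ofReal_ne_top, lintegral_gaussianPDF_linear hb,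
    ← ENNReal.ofReal_mul (driftPotential_nonneg _ _)]
  simp [driftPotential]

/-! ### Concentrating strip densities -/

/-- Integrals against densities that concentrate at a point converge to the value there of any
function that is continuous at that point. -/
lemma tendsto_lintegral_of_concentrating {α ι : Type*} [TopologicalSpace α] [MeasurableSpace α]
    {μ : Measure α} {l : Filter ι} {k : ι → α → ℝ≥0∞} {a : α}
    (hk : ∀ᶠ i in l, ∫⁻ x, k i x ∂μ = 1)
    (hsupp : ∀ U ∈ 𝓝 a, ∀ᶠ i in l, ∀ x, x ∉ U → k i x = 0) {G : α → ℝ≥0∞}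
    (hG : ContinuousAt G a) :
    Tendsto (fun i ↦ ∫⁻ x, k i x * G x ∂μ) l (𝓝 (G a)) := by
  refine tendsto_order.2 ⟨fun m hm ↦ ?_, fun m hm ↦ ?_⟩
  · obtain ⟨r, hmr, hr⟩ := exists_between hm
    filter_upwards [hk, hsupp _ (hG.eventually_const_lt hr)] with i hi hs
    refine hmr.trans_le ?_
    calc r = ∫⁻ x, k i x * r ∂μ := by
            rw [lintegral_mul_const' _ _ hr.ne_top, hi, one_mul]
      _ ≤ _ := by
        refine lintegral_mono fun x ↦ ?_
        by_cases hx : r < G x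
        · gcongr
        · simp [hs x hx]
  · obtain ⟨r, hr, hmr⟩ := exists_between hm
    filter_upwards [hk, hsupp _ (hG.eventually_lt_const hr)] with i hi hs
    refine lt_of_le_of_lt ?_ hmr
    calc _ ≤ ∫⁻ x, k i x * r ∂μ := by
            refine lintegral_mono fun x ↦ ?_
            by_cases hx : G x < r
            · gcongr
            · simp [hs x hx]
      _ = r := by rw [lintegral_mul_const' _ _ hmr.ne_top, hi, one_mul]

/-- The uniform density on the interval of width `ε` around `0`. -/
noncomputable def stripDensity (ε : ℝ) : ℝ → ℝ≥0∞ :=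
  (Set.Icc (-(ε / 2)) (ε / 2)).indicator fun _ ↦ ENNReal.ofReal ε⁻¹

lemma measurable_stripDensity (ε : ℝ) : Measurable (stripDensity ε) :=
  measurable_const.indicator measurableSet_Icc

lemma lintegral_stripDensity {ε : ℝ} (hε : 0 < ε) : ∫⁻ x, stripDensity ε x = 1 := by
  rw [stripDensity, lintegral_indicator measurableSet_Icc, setLIntegral_const, Real.volume_Icc,
    ← ENNReal.ofReal_mul (by positivity)]
  field_simp
  simp

lemma stripDensity_of_nonpos {ε : ℝ} (hε : ε ≤ 0) : stripDensity ε = 0 := by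
  ext x
  simp [stripDensity, hε]

/-- Nonpositive `ε` is included because the `L²` argument later requires square integrability of
every member of a family indexed by all real `ε`. -/
lemma lintegral_stripDensity_le (ε : ℝ) : ∫⁻ x, stripDensity ε x ≤ 1 := by
  rcases le_or_gt ε 0 with hε | hε
  · simp [stripDensity_of_nonpos hε]
  · exact (lintegral_stripDensity hε).le

lemma stripDensity_eq_zero {ε x : ℝ} (hx : ε / 2 < |x|) : stripDensity ε x = 0 := by
  refine Set.indicator_of_notMem (fun h ↦ ?_) _
  exact absurd (abs_le.2 h) (not_le.2 hx)

lemma eventually_stripDensity_eq_zero {U : Set ℝ} (hU : U ∈ 𝓝 0) :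
    ∀ᶠ ε in 𝓝[>] (0 : ℝ), ∀ x, x ∉ U → stripDensity ε x = 0 := by
  obtain ⟨r, hr, hrU⟩ := Metric.mem_nhds_iff.1 hU
  filter_upwards [Ioo_mem_nhdsGT hr] with ε hε x hx
  refine stripDensity_eq_zero ?_
  have : r ≤ |x| := by
    by_contra! h
    exact hx (hrU (by simpa using h))
  linarith [hε.1, hε.2]

lemma tendsto_lintegral_stripDensity {G : ℝ → ℝ≥0∞} (hG : ContinuousAt G 0) :
    Tendsto (fun ε ↦ ∫⁻ x, stripDensity ε x * G x) (𝓝[>] 0) (𝓝 (G 0)) := by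
  refine tendsto_lintegral_of_concentrating ?_ (fun U hU ↦ eventually_stripDensity_eq_zero hU) hG
  filter_upwards [self_mem_nhdsWithin] with ε hε using lintegral_stripDensity hε

lemma tendsto_lintegral_stripDensity_mul {G : ℝ × ℝ → ℝ≥0∞} (hGm : Measurable G)
    (hG : ContinuousAt G (0, 0)) :
    Tendsto (fun p : ℝ × ℝ ↦ ∫⁻ x, ∫⁻ y, stripDensity p.1 x * stripDensity p.2 y * G (x, y))
      (𝓝[>] 0 ×ˢ 𝓝[>] 0) (𝓝 (G (0, 0))) := by
  have h := tendsto_lintegral_of_concentrating (μ := (volume : Measure ℝ).prod volume)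
    (l := 𝓝[>] (0 : ℝ) ×ˢ 𝓝[>] (0 : ℝ))
    (k := fun p z ↦ stripDensity p.1 z.1 * stripDensity p.2 z.2) ?_ ?_ hG
  · refine h.congr fun p ↦ ?_
    rw [lintegral_prod]
    have h1 := measurable_stripDensity p.1
    have h2 := measurable_stripDensity p.2
    fun_prop
  · filter_upwards [prod_mem_prod self_mem_nhdsWithin self_mem_nhdsWithin] with p hp
    rw [lintegral_prod_mul (measurable_stripDensity _).aemeasurable
      (measurable_stripDensity _).aemeasurable, lintegral_stripDensity hp.1,
      lintegral_stripDensity hp.2, one_mul]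
  · intro U hU
    obtain ⟨A, hA, B, hB, hAB⟩ := mem_nhds_prod_iff.1 hU
    filter_upwards [(eventually_stripDensity_eq_zero hA).prod_inl _,
      (eventually_stripDensity_eq_zero hB).prod_inr _] with p h1 h2 z hz
    by_cases hzA : z.1 ∈ A
    · rw [h2 z.2 fun hzB ↦ hz (hAB ⟨hzA, hzB⟩), mul_zero]
    · rw [h1 z.1 hzA, zero_mul]

/-! ### Limits of the first and second moments -/

section Moments

variable {Ω : Type*} [MeasurableSpace Ω] {P : Measure Ω} [SFinite P] {X : ℝ≥0 → Ω → ℝ}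

lemma tendsto_lintegral_rayOccupation (hX : IsPreBrownianReal X P)
    (hm : Measurable (Function.uncurry X)) {b : ℝ} (hb : b ≠ 0) :
    Tendsto (fun ε ↦ ∫⁻ ω, rayOccupation X (stripDensity ε) b ω ∂P) (𝓝[>] 0)
      (𝓝 (ENNReal.ofReal |b|⁻¹)) := by
  have h := tendsto_lintegral_stripDensity
    (ENNReal.continuous_ofReal.comp (continuous_driftPotential b)).continuousAt
  simp_rw [lintegral_rayOccupation hX hm (measurable_stripDensity _) hb]
  simpa [driftPotential] using h

lemma tendsto_lintegral_rayOccupation_mul (hX : IsPreBrownianReal X P)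
    (hm : Measurable (Function.uncurry X)) {b c : ℝ} (hb : b ≠ 0) (hc : c ≠ 0) :
    Tendsto (fun p : ℝ × ℝ ↦ ∫⁻ ω, rayOccupation X (stripDensity p.1) b ω *
      rayOccupation X (stripDensity p.2) c ω ∂P) (𝓝[>] 0 ×ˢ 𝓝[>] 0)
      (𝓝 (rayKernel b c 0 0 + rayKernel c b 0 0)) := by
  simp_rw [lintegral_rayOccupation_mul hX hm (measurable_stripDensity _)
    (measurable_stripDensity _) hb hc]
  have h1 := tendsto_lintegral_stripDensity_mul (measurable_rayKernel b c)
    (continuousAt_rayKernel hb c)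
  -- For `t < s` the slopes exchange roles, and the two widths with them.
  have h2 := (tendsto_lintegral_stripDensity_mul (measurable_rayKernel c b)
    (continuousAt_rayKernel hc b)).comp (tendsto_prod_swap (f := 𝓝[>] 0) (g := 𝓝[>] 0))
  exact h1.add h2

lemma lintegral_rayOccupation_sq_lt_top (hX : IsPreBrownianReal X P)
    (hm : Measurable (Function.uncurry X)) {b : ℝ} (hb : b ≠ 0) (ε : ℝ) :
    ∫⁻ ω, rayOccupation X (stripDensity ε) b ω * rayOccupation X (stripDensity ε) b ω ∂P < ∞ := by
  rw [lintegral_rayOccupation_mul hX hm (measurable_stripDensity _)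
    (measurable_stripDensity _) hb hb]
  have h : ∫⁻ x, ∫⁻ y, stripDensity ε x * stripDensity ε y * rayKernel b b x y ≤
      ENNReal.ofReal |b|⁻¹ * ENNReal.ofReal |b|⁻¹ := by
    calc
      _ ≤ ∫⁻ x, ∫⁻ y, stripDensity ε x * stripDensity ε y *
            (ENNReal.ofReal |b|⁻¹ * ENNReal.ofReal |b|⁻¹) := by
        gcongr
        exact rayKernel_le hb _ _ _
      _ = (∫⁻ x, stripDensity ε x) * (∫⁻ y, stripDensity ε y) *
            (ENNReal.ofReal |b|⁻¹ * ENNReal.ofReal |b|⁻¹) := by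
        simp_rw [lintegral_mul_const' _ _ (ENNReal.mul_ne_top ENNReal.ofReal_ne_top
          ENNReal.ofReal_ne_top)]
        rw [lintegral_lintegral_mul (measurable_stripDensity _).aemeasurable
          (measurable_stripDensity _).aemeasurable]
      _ ≤ 1 * 1 * (ENNReal.ofReal |b|⁻¹ * ENNReal.ofReal |b|⁻¹) := by
        gcongr <;> exact lintegral_stripDensity_le ε
      _ = _ := by simp
  exact (add_le_add h h).trans_lt (by finiteness)

end Moments

/-! ### From almost surely continuous paths to relative times -/

/-- Tonelli needs joint measurability. Paths are set to zero off a measurable set of full measure on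
which they are continuous and agree with measurable representatives at a countable dense set of
times; other times follow as limits. -/
lemma ProbabilityTheory.IsBrownianReal.exists_continuous_measurable {Ω : Type*}
    [MeasurableSpace Ω] {P : Measure Ω} {W : ℝ≥0 → Ω → ℝ} (hW : IsBrownianReal W P) :
    ∃ X : ℝ≥0 → Ω → ℝ, IsPreBrownianReal X P ∧ (∀ ω, Continuous (X · ω)) ∧
      (∀ t, Measurable (X t)) ∧ ∀ᵐ ω ∂P, ∀ t, X t ω = W t ω := by
  let d := TopologicalSpace.denseSeq ℝ≥0
  have hae : ∀ᵐ ω ∂P, Continuous (W · ω) ∧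
      ∀ n, W (d n) ω = (hW.aemeasurable (d n)).mk (W (d n)) ω :=
    hW.cont.and (ae_all_iff.2 fun n ↦ (hW.aemeasurable (d n)).ae_eq_mk)
  obtain ⟨G, hG, hGm, hGp⟩ := hae.exists_measurable_mem
  have hcont : ∀ ω, Continuous fun t ↦ G.indicator (W t) ω := by
    intro ω
    by_cases hω : ω ∈ G
    · simpa [hω] using (hGp ω hω).1
    · simp [hω, continuous_const]
  have hd : ∀ n, Measurable (G.indicator (W (d n))) := by
    intro n
    have : G.indicator (W (d n)) = G.indicator ((hW.aemeasurable (d n)).mk (W (d n))) :=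
      Set.indicator_congr fun ω hω ↦ (hGp ω hω).2 n
    rw [this]
    exact (hW.aemeasurable (d n)).measurable_mk.indicator hGm
  have heq : ∀ᵐ ω ∂P, ∀ t, G.indicator (W t) ω = W t ω := by
    filter_upwards [hG] with ω hω t using Set.indicator_of_mem hω _
  refine ⟨fun t ↦ G.indicator (W t), ?_, hcont, fun t ↦ ?_, heq⟩
  · exact hW.toIsPreBrownianReal.congr fun t ↦ by
      filter_upwards [heq] with ω hω using (hω t).symm
  · obtain ⟨u, hu, hut⟩ := mem_closure_iff_seq_limit.1
      (TopologicalSpace.denseRange_denseSeq ℝ≥0 t)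
    refine measurable_of_tendsto_metrizable (f := fun k ↦ G.indicator (W (u k))) (fun k ↦ ?_)
      (tendsto_pi_nhds.2 fun ω ↦ ((hcont ω).tendsto t).comp hut)
    obtain ⟨n, hn⟩ := hu k
    rw [← hn]
    exact hd n

lemma relTime_eq_toReal_rayOccupation {Ω : Type*} {X : ℝ≥0 → Ω → ℝ} {ω : Ω}
    (hX : Continuous (X · ω)) (ε b : ℝ) :
    relTime X ε b ω = (rayOccupation X (stripDensity ε) b ω).toReal := by
  set A : Set ℝ := {t : ℝ | X t.toNNReal ω ∈ Set.Icc (b * t - ε / 2) (b * t + ε / 2)} with hA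
  have hAm : MeasurableSet A := by
    have h1 : Continuous fun t : ℝ ↦ X t.toNNReal ω := hX.comp continuous_real_toNNReal
    exact (measurableSet_le (by fun_prop) h1.measurable).inter
      (measurableSet_le h1.measurable (by fun_prop))
  have hocc : rayOccupation X (stripDensity ε) b ω =
      ENNReal.ofReal ε⁻¹ * volume (A ∩ Set.Ioi 0) := by
    have : ∀ t : ℝ, stripDensity ε (X t.toNNReal ω - b * t) =
        A.indicator (fun _ ↦ ENNReal.ofReal ε⁻¹) t := by
      intro t
      simp only [stripDensity, Set.indicator, hA, Set.mem_Icc, Set.mem_ofPred_eq]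
      congr 1
      grind
    simp_rw [rayOccupation, this]
    rw [lintegral_indicator hAm, setLIntegral_const, Measure.restrict_apply hAm]
  have hvol : volume {t : ℝ | 0 ≤ t ∧ X t.toNNReal ω ∈
      Set.Icc (b * t - ε / 2) (b * t + ε / 2)} = volume (A ∩ Set.Ioi 0) := by
    have : {t : ℝ | 0 ≤ t ∧ X t.toNNReal ω ∈ Set.Icc (b * t - ε / 2) (b * t + ε / 2)} =
        A ∩ Set.Ici 0 := by
      ext t
      exact and_comm
    rw [this]
    exact measure_congr ((ae_eq_refl A).inter Ioi_ae_eq_Ici.symm)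
  rw [relTime, Measure.real, hvol, hocc, ENNReal.toReal_mul, one_div]
  -- For `ε < 0` the strip is empty, so both sides vanish.
  rcases le_or_gt 0 ε with hε | hε
  · rw [ENNReal.toReal_ofReal (inv_nonneg.2 hε)]
  · have : A = ∅ := by
      ext t
      simp only [hA, Set.mem_Icc, Set.mem_ofPred_eq, Set.mem_empty_iff_false, iff_false]
      intro h
      linarith [h.1, h.2]
    simp [this]

lemma relTime_eq_fun {Ω : Type*} {X : ℝ≥0 → Ω → ℝ} (hc : ∀ ω, Continuous (X · ω))
    (ε b : ℝ) :
    relTime X ε b = fun ω ↦ (rayOccupation X (stripDensity ε) b ω).toReal :=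
  funext fun ω ↦ relTime_eq_toReal_rayOccupation (hc ω) ε b

section Moments

variable {Ω : Type*} [MeasurableSpace Ω] {P : Measure Ω} [IsProbabilityMeasure P]
  {X : ℝ≥0 → Ω → ℝ}

lemma ae_rayOccupation_lt_top (hX : IsPreBrownianReal X P)
    (hm : Measurable (Function.uncurry X)) {b : ℝ} (hb : b ≠ 0) (ε : ℝ) :
    ∀ᵐ ω ∂P, rayOccupation X (stripDensity ε) b ω < ∞ := by
  have h := measurable_rayOccupation hm (measurable_stripDensity ε) b
  filter_upwards [ae_lt_top (h.mul h) (lintegral_rayOccupation_sq_lt_top hX hm hb ε).ne]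
    with ω hω
  by_contra! htop
  rw [top_le_iff] at htop
  simp [htop] at hω

lemma measurable_relTime (hc : ∀ ω, Continuous (X · ω))
    (hm : Measurable (Function.uncurry X)) (ε b : ℝ) : Measurable (relTime X ε b) := by
  rw [relTime_eq_fun hc]
  exact (measurable_rayOccupation hm (measurable_stripDensity ε) b).ennreal_toReal

lemma memLp_relTime (hX : IsPreBrownianReal X P) (hc : ∀ ω, Continuous (X · ω))
    (hm : Measurable (Function.uncurry X)) {b : ℝ} (hb : b ≠ 0) (ε : ℝ) :
    MemLp (relTime X ε b) 2 P := by
  have h := measurable_rayOccupation hm (measurable_stripDensity ε) b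
  rw [memLp_two_iff_integrable_sq (measurable_relTime hc hm ε b).aestronglyMeasurable]
  refine (integrable_toReal_of_lintegral_ne_top (h.mul h).aemeasurable
    (lintegral_rayOccupation_sq_lt_top hX hm hb ε).ne).congr (ae_of_all _ fun ω ↦ ?_)
  simp [relTime_eq_fun hc, ENNReal.toReal_mul, sq]

lemma integral_relTime (hX : IsPreBrownianReal X P) (hc : ∀ ω, Continuous (X · ω))
    (hm : Measurable (Function.uncurry X)) {b : ℝ} (hb : b ≠ 0) (ε : ℝ) :
    ∫ ω, relTime X ε b ω ∂P = (∫⁻ ω, rayOccupation X (stripDensity ε) b ω ∂P).toReal := by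
  rw [relTime_eq_fun hc, integral_toReal
    (measurable_rayOccupation hm (measurable_stripDensity ε) b).aemeasurable
    (ae_rayOccupation_lt_top hX hm hb ε)]

lemma integral_relTime_mul (hX : IsPreBrownianReal X P) (hc : ∀ ω, Continuous (X · ω))
    (hm : Measurable (Function.uncurry X)) {b c : ℝ} (hb : b ≠ 0) (hc' : c ≠ 0) (ε δ : ℝ) :
    ∫ ω, relTime X ε b ω * relTime X δ c ω ∂P =
      (∫⁻ ω, rayOccupation X (stripDensity ε) b ω *
        rayOccupation X (stripDensity δ) c ω ∂P).toReal := by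
  rw [relTime_eq_fun hc, relTime_eq_fun hc]
  simp_rw [← ENNReal.toReal_mul]
  refine integral_toReal ?_ ?_
  · exact ((measurable_rayOccupation hm (measurable_stripDensity ε) b).mul
      (measurable_rayOccupation hm (measurable_stripDensity δ) c)).aemeasurable
  · filter_upwards [ae_rayOccupation_lt_top hX hm hb ε, ae_rayOccupation_lt_top hX hm hc' δ]
      with ω h1 h2 using ENNReal.mul_lt_top h1 h2

lemma rayKernel_ne_top {b : ℝ} (hb : b ≠ 0) (c x y : ℝ) : rayKernel b c x y ≠ ∞ :=
  ((rayKernel_le hb c x y).trans_lt (by finiteness)).ne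

lemma tendsto_integral_relTime (hX : IsPreBrownianReal X P) (hc : ∀ ω, Continuous (X · ω))
    (hm : Measurable (Function.uncurry X)) {b : ℝ} (hb : b ≠ 0) :
    Tendsto (fun ε ↦ ∫ ω, relTime X ε b ω ∂P) (𝓝[>] 0) (𝓝 |b|⁻¹) := by
  simp_rw [integral_relTime hX hc hm hb]
  have h := (ENNReal.tendsto_toReal ENNReal.ofReal_ne_top).comp
    (tendsto_lintegral_rayOccupation hX hm hb)
  rwa [ENNReal.toReal_ofReal (by positivity)] at h

lemma tendsto_integral_relTime_mul (hX : IsPreBrownianReal X P)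
    (hc : ∀ ω, Continuous (X · ω)) (hm : Measurable (Function.uncurry X)) {b c : ℝ}
    (hb : b ≠ 0) (hc' : c ≠ 0) :
    Tendsto (fun p : ℝ × ℝ ↦ ∫ ω, relTime X p.1 b ω * relTime X p.2 c ω ∂P)
      (𝓝[>] 0 ×ˢ 𝓝[>] 0) (𝓝 ((rayKernel b c 0 0).toReal + (rayKernel c b 0 0).toReal)) := by
  simp_rw [integral_relTime_mul hX hc hm hb hc']
  rw [← ENNReal.toReal_add (rayKernel_ne_top hb _ _ _) (rayKernel_ne_top hc' _ _ _)]
  exact (ENNReal.tendsto_toReal (ENNReal.add_ne_top.2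
    ⟨rayKernel_ne_top hb _ _ _, rayKernel_ne_top hc' _ _ _⟩)).comp
    (tendsto_lintegral_rayOccupation_mul hX hm hb hc')

end Moments

/-! ### Limits in `L²` and in measure -/

/-- `‖f i - f j‖²` expands into inner products and tends to `m - 2m + m = 0`, so `f` is Cauchy. -/
lemma exists_tendsto_of_tendsto_inner {H ι : Type*} [NormedAddCommGroup H]
    [InnerProductSpace ℝ H] [CompleteSpace H] {l : Filter ι} [l.NeBot] {f : ι → H} {m : ℝ}
    (h : Tendsto (fun p : ι × ι ↦ inner ℝ (f p.1) (f p.2)) (l ×ˢ l) (𝓝 m)) :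
    ∃ x, Tendsto f l (𝓝 x) := by
  have hdiag : Tendsto (fun i ↦ inner ℝ (f i) (f i)) l (𝓝 m) :=
    h.comp (tendsto_id.prodMk tendsto_id)
  have hsq : Tendsto (fun p : ι × ι ↦ ‖f p.1 - f p.2‖ ^ 2) (l ×ˢ l) (𝓝 0) := by
    have h1 := ((hdiag.comp tendsto_fst).sub (h.const_mul 2)).add (hdiag.comp
      (tendsto_snd (f := l) (g := l)))
    rw [show m - 2 * m + m = 0 by ring] at h1
    refine h1.congr fun p ↦ ?_
    rw [norm_sub_sq_real, ← real_inner_self_eq_norm_sq, ← real_inner_self_eq_norm_sq]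
    rfl
  have hdist : Tendsto (fun p : ι × ι ↦ dist (f p.1) (f p.2)) (l ×ˢ l) (𝓝 0) := by
    have h2 := hsq.sqrt
    rw [Real.sqrt_zero] at h2
    refine h2.congr fun p ↦ ?_
    rw [Real.sqrt_sq (norm_nonneg _), dist_eq_norm]
  exact CompleteSpace.complete (cauchy_map_iff.2
    ⟨‹_›, tendsto_uniformity_iff_dist_tendsto_zero.2 hdist⟩)

lemma inner_toLp_two {Ω : Type*} [MeasurableSpace Ω] {P : Measure Ω} {f g : Ω → ℝ}
    (hf : MemLp f 2 P) (hg : MemLp g 2 P) :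
    inner ℝ (hf.toLp f) (hg.toLp g) = ∫ ω, f ω * g ω ∂P := by
  rw [L2.inner_def]
  refine integral_congr_ae ?_
  filter_upwards [hf.coeFn_toLp, hg.coeFn_toLp] with ω h1 h2
  simp [h1, h2, mul_comm]

/-- A family of square integrable functions whose mutual second moments converge has limits in
`L²`, and first and second moments pass to the limit. -/
lemma exists_L2_limit {Ω S ι : Type*} [MeasurableSpace Ω] {P : Measure Ω}
    [IsProbabilityMeasure P] {l : Filter ι} [l.NeBot] {Y : ι → S → Ω → ℝ}
    (hY : ∀ i b, MemLp (Y i b) 2 P) {e : S → ℝ} {m : S → S → ℝ}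
    (he : ∀ b, Tendsto (fun i ↦ ∫ ω, Y i b ω ∂P) l (𝓝 (e b)))
    (hm : ∀ b c, Tendsto (fun p : ι × ι ↦ ∫ ω, Y p.1 b ω * Y p.2 c ω ∂P) (l ×ˢ l)
      (𝓝 (m b c))) :
    ∃ V : S → Ω → ℝ, (∀ b, MemLp (V b) 2 P) ∧
      (∀ b, Tendsto (fun i ↦ eLpNorm (Y i b - V b) 2 P) l (𝓝 0)) ∧
      (∀ b, ∫ ω, V b ω ∂P = e b) ∧ ∀ b c, ∫ ω, V b ω * V c ω ∂P = m b c := by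
  have hlim : ∀ b, ∃ x : Lp ℝ 2 P, Tendsto (fun i ↦ (hY i b).toLp (Y i b)) l (𝓝 x) := by
    intro b
    refine exists_tendsto_of_tendsto_inner (m := m b b) ?_
    simp_rw [inner_toLp_two]
    exact hm b b
  choose V hV using hlim
  have hVm : ∀ b, MemLp (V b) 2 P := fun b ↦ Lp.memLp (V b)
  have hV' : ∀ b, Tendsto (fun i ↦ (hY i b).toLp (Y i b)) l (𝓝 ((hVm b).toLp (V b))) := by
    intro b
    rw [Lp.toLp_coeFn]
    exact hV b
  refine ⟨fun b ↦ V b, hVm, fun b ↦ ?_, fun b ↦ ?_, fun b c ↦ ?_⟩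
  · exact (Lp.tendsto_Lp_iff_tendsto_eLpNorm'' _ (fun i ↦ hY i b) _ (hVm b)).1 (hV' b)
  -- The mean is the inner product with the constant `1`.
  · have h1 : MemLp (fun _ : Ω ↦ (1 : ℝ)) 2 P := memLp_const 1
    have h2 := (hV' b).inner (𝕜 := ℝ) (tendsto_const_nhds (x := h1.toLp _))
    simp_rw [inner_toLp_two, mul_one] at h2
    exact tendsto_nhds_unique h2 (he b)
  · have h2 := (hV' b).inner (𝕜 := ℝ) (hV' c)
    simp_rw [inner_toLp_two] at h2
    exact tendsto_nhds_unique h2 ((hm b c).comp (tendsto_id.prodMk tendsto_id))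

/-- In the sup distance, a deviation of at least `ε` forces one in some coordinate, so a finite
union bound suffices. -/
lemma tendstoInMeasure_pi {Ω ι κ : Type*} [MeasurableSpace Ω] {P : Measure Ω} [Fintype κ]
    {l : Filter ι} {f : ι → κ → Ω → ℝ} {g : κ → Ω → ℝ}
    (h : ∀ k, TendstoInMeasure P (fun i ↦ f i k) l (g k)) :
    TendstoInMeasure P (fun i ω k ↦ f i k ω) l fun ω k ↦ g k ω := by
  intro ε hε
  have hsum : Tendsto (fun i ↦ ∑ k, P {ω | ε ≤ edist (f i k ω) (g k ω)}) l (𝓝 0) := by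
    simpa using tendsto_finsetSum Finset.univ fun k _ ↦ h k ε hε
  refine tendsto_of_tendsto_of_tendsto_of_le_of_le tendsto_const_nhds hsum
    (fun _ ↦ zero_le) fun i ↦ ?_
  refine (measure_mono fun ω hω ↦ ?_).trans (measure_iUnion_fintype_le P _)
  by_contra! hcon
  simp only [Set.mem_iUnion, Set.mem_ofPred_eq, not_exists, not_le] at hcon
  have : edist (fun k ↦ f i k ω) (fun k ↦ g k ω) < ε := by
    rw [edist_pi_def, Finset.sup_lt_iff hε]
    exact fun k _ ↦ hcon k
  exact absurd hω (not_le.2 this)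

/-! ### Existence, uniqueness in law, and covariances -/

section TotalRelTime

variable {Ω Ω' Ω'' : Type*} [MeasurableSpace Ω] [MeasurableSpace Ω'] [MeasurableSpace Ω'']
  {P : Measure Ω} [IsProbabilityMeasure P] {P' : Measure Ω'} [IsProbabilityMeasure P']
  {P'' : Measure Ω''} [IsProbabilityMeasure P''] {W : ℝ≥0 → Ω → ℝ}

/-- A total relative time process with explicit first and second moments. -/
lemma exists_isTotalRelTime (hW : IsBrownianReal W P) :
    ∃ V : ℝ → Ω → ℝ, IsTotalRelTime W P V P ∧ (∀ b, b ≠ 0 → MemLp (V b) 2 P) ∧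
      (∀ b, b ≠ 0 → ∫ ω, V b ω ∂P = |b|⁻¹) ∧
      ∀ b c, b ≠ 0 → c ≠ 0 → ∫ ω, V b ω * V c ω ∂P =
        (rayKernel b c 0 0).toReal + (rayKernel c b 0 0).toReal := by
  obtain ⟨X, hX, hc, hmt, hXW⟩ := hW.exists_continuous_measurable
  have hm : Measurable (Function.uncurry X) := measurable_uncurry_of_continuous_of_measurable hc hmt
  obtain ⟨V, hV2, hVlim, hVe, hVm⟩ := exists_L2_limit (S := {b : ℝ // b ≠ 0}) (l := 𝓝[>] (0 : ℝ))
    (Y := fun ε b ↦ relTime X ε b) (fun ε b ↦ memLp_relTime hX hc hm b.2 ε)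
    (fun b ↦ tendsto_integral_relTime hX hc hm b.2)
    (fun b c ↦ tendsto_integral_relTime_mul hX hc hm b.2 c.2)
  have hrel : ∀ ε b, relTime X ε b =ᵐ[P] relTime W ε b := by
    intro ε b
    filter_upwards [hXW] with ω hω
    simp [relTime, hω]
  refine ⟨fun b ↦ if hb : b ≠ 0 then V ⟨b, hb⟩ else 0, fun n b hb ↦ ?_, fun b hb ↦ ?_,
    fun b hb ↦ ?_, fun b c hb hc ↦ ?_⟩
  -- `L²` convergence of each coordinate gives joint convergence in measure, hence in distribution.
  · have hpi : TendstoInMeasure P (fun (ε : ℝ) ω (i : Fin n) ↦ relTime X ε (b i) ω) (𝓝[>] 0)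
        fun ω i ↦ V ⟨b i, hb i⟩ ω :=
      tendstoInMeasure_pi (g := fun i ↦ V ⟨b i, hb i⟩) fun i ↦
        tendstoInMeasure_of_tendsto_eLpNorm two_ne_zero
          (fun ε ↦ (measurable_relTime hc hm ε (b i)).aestronglyMeasurable)
          (hV2 ⟨b i, hb i⟩).aestronglyMeasurable (hVlim ⟨b i, hb i⟩)
    have hdist := hpi.tendstoInDistribution fun ε ↦ aemeasurable_pi_lambda _ fun i ↦
      (measurable_relTime hc hm ε (b i)).aemeasurable
    refine hdist.congr (fun ε ↦ ?_) (ae_of_all _ fun ω ↦ ?_)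
    · filter_upwards [ae_all_iff.2 fun i ↦ hrel ε (b i)] with ω hω using funext hω
    · simp [hb]
  · simpa [hb] using hV2 ⟨b, hb⟩
  · simpa [hb] using hVe ⟨b, hb⟩
  · simpa [hb, hc] using hVm ⟨b, hb⟩ ⟨c, hc⟩

lemma IsTotalRelTime.identDistrib {V : ℝ → Ω' → ℝ} {U : ℝ → Ω'' → ℝ}
    (hV : IsTotalRelTime W P V P') (hU : IsTotalRelTime W P U P'') {b c : ℝ} (hb : b ≠ 0)
    (hc : c ≠ 0) :
    IdentDistrib (fun ω ↦ (V b ω, V c ω)) (fun ω ↦ (U b ω, U c ω)) P' P'' := by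
  have hbc : ∀ i, (![b, c] : Fin 2 → ℝ) i ≠ 0 := by
    intro i
    fin_cases i <;> simpa
  have h1 := hV 2 ![b, c] hbc
  have h2 := hU 2 ![b, c] hbc
  have h3 : IdentDistrib (fun ω (i : Fin 2) ↦ V ((![b, c] : Fin 2 → ℝ) i) ω)
      (fun ω (i : Fin 2) ↦ U ((![b, c] : Fin 2 → ℝ) i) ω) P' P'' :=
    ⟨h1.aemeasurable_limit, h2.aemeasurable_limit, tendstoInDistribution_unique _ h1 h2⟩
  exact h3.comp (u := fun v : Fin 2 → ℝ ↦ (v 0, v 1)) (by fun_prop)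

/-- The limit covariance of the relative times. -/
lemma IsTotalRelTime.memLp_and_covariance (hW : IsBrownianReal W P) {V : ℝ → Ω' → ℝ}
    (hV : IsTotalRelTime W P V P') {b c : ℝ} (hb : b ≠ 0) (hc : c ≠ 0) :
    MemLp (V b) 2 P' ∧ covariance (V b) (V c) P' =
      (rayKernel b c 0 0).toReal + (rayKernel c b 0 0).toReal - |b|⁻¹ * |c|⁻¹ := by
  -- Moments are computed for the `L²` limit `U` and carried to `V` by equality of the pair laws.
  obtain ⟨U, hU, hU2, hUe, hUm⟩ := exists_isTotalRelTime hW
  have hid := hV.identDistrib hU hb hc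
  have hid1 : IdentDistrib (V b) (U b) P' P := hid.comp measurable_fst
  have hid2 : IdentDistrib (V c) (U c) P' P := hid.comp measurable_snd
  have hVb : MemLp (V b) 2 P' := hid1.memLp_iff.2 (hU2 b hb)
  have hVc : MemLp (V c) 2 P' := hid2.memLp_iff.2 (hU2 c hc)
  refine ⟨hVb, ?_⟩
  have hmul : IdentDistrib (fun ω ↦ V b ω * V c ω) (fun ω ↦ U b ω * U c ω) P' P :=
    hid.comp (u := fun p : ℝ × ℝ ↦ p.1 * p.2) (by fun_prop)
  rw [covariance_eq_sub hVb hVc, hid1.integral_eq, hid2.integral_eq, hUe b hb, hUe c hc,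
    ← hUm b c hb hc, ← hmul.integral_eq]
  rfl

/-- `K(c,b) = 1/(bc)` cancels the product of the means, leaving `K(b,c)`. -/
lemma IsTotalRelTime.covariance_of_pos (hW : IsBrownianReal W P) {V : ℝ → Ω' → ℝ}
    (hV : IsTotalRelTime W P V P') {b c : ℝ} (hb : 0 < b) (hbc : b ≤ c) :
    covariance (V b) (V c) P' = 1 / (c * (2 * c - b)) := by
  have hc : 0 < c := hb.trans_le hbc
  have h2 : 0 < 2 * c - b := by linarith
  rw [(hV.memLp_and_covariance hW hb.ne' hc.ne').2,
    rayKernel_zero_of_nonneg hb.ne' (mul_nonneg hc.le (sub_nonneg.2 hbc)),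
    rayKernel_zero_of_nonpos hc.ne' (mul_nonpos_of_nonneg_of_nonpos hb.le (sub_nonpos.2 hbc)),
    ENNReal.toReal_ofReal (by positivity), ENNReal.toReal_ofReal (by positivity),
    abs_of_pos hb, abs_of_pos hc, abs_of_pos h2]
  field_simp
  ring

/-- With opposite signs both kernels fall under `rayKernel_zero_of_nonneg`, so nothing cancels. -/
lemma IsTotalRelTime.covariance_of_neg_of_pos (hW : IsBrownianReal W P) {V : ℝ → Ω' → ℝ}
    (hV : IsTotalRelTime W P V P') {c d : ℝ} (hc : 0 < c) (hd : 0 < d) :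
    covariance (V (-c)) (V d) P' =
      1 / (d * (c + 2 * d)) + 1 / (c * (2 * c + d)) - 1 / (c * d) := by
  have hc' : -c ≠ 0 := (neg_lt_zero.2 hc).ne
  rw [(hV.memLp_and_covariance hW hc' hd.ne').2,
    rayKernel_zero_of_nonneg hc' (by nlinarith [mul_pos hc hd]),
    rayKernel_zero_of_nonneg hd.ne' (by nlinarith [mul_pos hc hd]),
    ENNReal.toReal_ofReal (by positivity), ENNReal.toReal_ofReal (by positivity),
    abs_neg, abs_of_pos hc, abs_of_pos hd, show 2 * -c - d = -(2 * c + d) by ring, abs_neg,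
    abs_of_pos (by positivity : 0 < 2 * c + d), show 2 * d - -c = c + 2 * d by ring,
    abs_of_pos (by positivity : 0 < c + 2 * d)]
  field_simp

lemma IsTotalRelTime.variance_eq (hW : IsBrownianReal W P) {V : ℝ → Ω' → ℝ}
    (hV : IsTotalRelTime W P V P') {b : ℝ} (hb : b ≠ 0) :
    variance (V b) P' = (|b|⁻¹) ^ 2 := by
  obtain ⟨h1, h2⟩ := hV.memLp_and_covariance hW hb hb
  rw [← covariance_self h1.aestronglyMeasurable.aemeasurable, h2,
    rayKernel_zero_of_nonpos hb (by simp), ENNReal.toReal_ofReal (by positivity)]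
  ring

lemma IsTotalRelTime.correlation_eq (hW : IsBrownianReal W P) {V : ℝ → Ω' → ℝ}
    (hV : IsTotalRelTime W P V P') {b c : ℝ} (hb : b ≠ 0) (hc : c ≠ 0) :
    correlation (V b) (V c) P' = covariance (V b) (V c) P' * (|b| * |c|) := by
  rw [correlation, hV.variance_eq hW hb, hV.variance_eq hW hc, Real.sqrt_sq (by positivity),
    Real.sqrt_sq (by positivity), div_eq_mul_inv, mul_inv, inv_inv, inv_inv]

end TotalRelTime

theorem mainTheorem6 {Ω : Type*} [MeasurableSpace Ω] (P : Measure Ω) [IsProbabilityMeasure P]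
    (W : ℝ≥0 → Ω → ℝ) (hW : IsBrownianReal W P) :
    -- the limit process exists
    (∃ V : ℝ → Ω → ℝ, IsTotalRelTime W P V P) ∧
    -- and every such process has the following covariances and correlations
    (∀ (Ω' : Type*) [MeasurableSpace Ω'] (P' : Measure Ω') [IsProbabilityMeasure P']
        (V : ℝ → Ω' → ℝ), IsTotalRelTime W P V P' →
      (∀ b : ℝ, b ≠ 0 → MemLp (V b) 2 P') ∧
      (∀ b c : ℝ, 0 < b → b < c →
        covariance (V b) (V c) P' = 1 / (c * (2 * c - b))) ∧
      (∀ c d : ℝ, -c < 0 → 0 < d →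
        covariance (V (-c)) (V d) P' =
          1 / (d * (c + 2 * d)) + 1 / (c * (2 * c + d)) - 1 / (c * d)) ∧
      (∀ b h : ℝ, 0 < b → 0 < h →
        correlation (V b) (V (b + h)) P' = b / (b + 2 * h)) ∧
      (∀ c k : ℝ, 0 < c → 0 < k →
        correlation (V (-c)) (V (k * c)) P' = -(3 * k / ((k + 2) * (2 * k + 1))))) := by
  refine ⟨(exists_isTotalRelTime hW).imp fun V hV ↦ hV.1, fun Ω' _ P' _ V hV ↦ ?_⟩
  refine ⟨fun b hb ↦ (hV.memLp_and_covariance hW hb hb).1,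
    fun b c hb hbc ↦ hV.covariance_of_pos hW hb hbc.le,
    fun c d hc hd ↦ hV.covariance_of_neg_of_pos hW (neg_lt_zero.1 hc) hd,
    fun b h hb hh ↦ ?_, fun c k hc hk ↦ ?_⟩
  · have hbh : 0 < b + h := add_pos hb hh
    rw [hV.correlation_eq hW hb.ne' hbh.ne', hV.covariance_of_pos hW hb (by linarith),
      abs_of_pos hb, abs_of_pos hbh, show 2 * (b + h) - b = b + 2 * h by ring]
    field_simp
  · have hkc : 0 < k * c := mul_pos hk hc
    rw [hV.correlation_eq hW (neg_lt_zero.2 hc).ne hkc.ne',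
      hV.covariance_of_neg_of_pos hW hc hkc, abs_neg, abs_of_pos hc, abs_of_pos hkc]
    field_simp
    ring
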